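/- Consider deterministic Turing machines with the tape alphabet $\{0,1,\text{blank}\}$, finitely many states $\{0,\dots,n\}$ with initial state $0$, and a partial transition function (in one step a machine rewrites the scanned cells, moves each head by at most one cell and changes its state; it halts where the transition function is undefined). The input is written on the first tape, and the computed word is the content of the first tape after halting. Let $U$ be such a machine with any number of tapes which is universal for the single-tape machines $Z$: each $Z$ is described by a self-delimiting word, again denoted $Z$ (no such word is a prefix of the word of another machine), and $U(Zx)=Z(x)$ for every input $x\in\{0,1\}^*$, one side being defined exactly when the other is. Let $t_U(y)$ be the number of steps of $U$ on input $y$, let $t_Z(n)$ be the worst-case number of steps of $Z$ on inputs of length $n$ (both are $\infty$ in case of non-halting), and suppose that there is a constant $c_{init}$, and for each $Z$ a constant $c_{run}$, such that for all $x$ \[ t_U(Zx)\le c_{init}\,|Zx| + c_{run}\, t_Z(|x|). \] Such universal machines $U$ exist. For a word $w\in\{0,1\}^*$ put \[ K(w)=\min\{|Zx| : U(Zx)=w\},\qquad K_T(w)=\min\{t_U(Zx) : U(Zx)=w,\ |Zx|=K(w)\}. \] Theorem. For every such $U$ there is a constant $c$ such that for every machine $Z_{trivial}$ that halts immediately whatever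 it reads, and for every word $w$, \[ K(w)=|w|+|Z_{trivial}| \ \Longrightarrow\ K_T(w)\le c\,K(w). \] -/

import Mathlib

namespace Kolm

/-- A deterministic Turing machine with one input/output tape (tape `0`) and `k` further work
tapes. The tape alphabet is `{0, 1, blank}`, written `Option Bool` with `none` the blank. The set
of states is `{0, ..., n}` with initial state `0`. The transition function is partial: from the
state and the scanned symbols it yields the new state, the symbols to be written and the moves of
the heads (`none` means that the head stays); the machine halts where it is undefined. -/
@[ext]
structure Machine (k : ℕ) where
  n : ℕ
  δ : Fin (n + 1) → (Fin (k + 1) → Option Bool) →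
    Option (Fin (n + 1) × (Fin (k + 1) → Option Bool) × (Fin (k + 1) → Option Turing.Dir))

namespace Machine

variable {k : ℕ}

/-- A configuration: the state, and the tapes with the positions of their heads. -/
structure Cfg (M : Machine k) where
  state : Fin (M.n + 1)
  tape : Fin (k + 1) → Turing.Tape (Option Bool)

/-- Writing a symbol on the scanned cell and then moving the head. -/
def act (T : Turing.Tape (Option Bool)) (a : Option Bool) : Option Turing.Dir → Turing.Tape (Option Bool)
  | none => T.write a
  | some d => (T.write a).move d

/-- One step of computation; `none` if the machine has halted. -/
def step (M : Machine k) (c : M.Cfg) : Option M.Cfg :=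
  (M.δ c.state fun i => (c.tape i).head).map fun r =>
    ⟨r.1, fun i => act (c.tape i) (r.2.1 i) (r.2.2 i)⟩

/-- The initial configuration: tape `0` holds the input `x`, with its head on the first letter,
and the work tapes are blank. -/
def init (M : Machine k) (x : List Bool) : M.Cfg :=
  ⟨0, fun i => if i = 0 then Turing.Tape.mk₁ (x.map some) else Turing.Tape.mk₁ []⟩

/-- The configuration after a number of steps on input `x`; `none` if the machine has halted
earlier. -/
def run (M : Machine k) (x : List Bool) : ℕ → Option M.Cfg
  | 0 => some (M.init x)
  | m + 1 => (M.run x m).bind M.step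

/-- On input `x` the machine halts after exactly `m` steps, in the configuration `c`. -/
def HaltsAt (M : Machine k) (x : List Bool) (m : ℕ) (c : M.Cfg) : Prop :=
  M.run x m = some c ∧ M.step c = none

/-- The number of steps of `M` on input `x`; it is `⊤` if `M` does not halt on `x`. -/
noncomputable def time (M : Machine k) (x : List Bool) : ℕ∞ :=
  ⨅ (m : ℕ) (_ : ∃ c, M.HaltsAt x m c), (m : ℕ∞)

/-- The worst-case time complexity of `M` on inputs of length `l`. -/
noncomputable def timeComplexity (M : Machine k) (l : ℕ) : ℕ∞ :=
  ⨆ (x : List Bool) (_ : x.length = l), M.time x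

/-- The content of the tape is the word `w`, in consecutive cells, and blanks elsewhere; the
position of the head is irrelevant. -/
def Reads (T : Turing.Tape (Option Bool)) (w : List Bool) : Prop :=
  ∃ i : ℤ, ∀ j : ℤ, T.nth j = if j < i then none else w[(j - i).toNat]?

/-- `M` halts on input `x` and the computed word is `w`, that is, `M(x) = w`. -/
def Outputs (M : Machine k) (x w : List Bool) : Prop :=
  ∃ m c, M.HaltsAt x m c ∧ Reads (c.tape 0) w

end Machine

/-- `Z` halts at once, whatever it reads. -/
def ImmediatelyHalts (Z : Machine 0) : Prop :=
  ∀ a, Z.δ 0 a = none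

/-- `U` is a universal machine for the single-tape machines `Z`, described by self-delimiting
words `e Z`: on the input `e Z ++ x` it computes what `Z` computes on `x`. -/
structure IsUniversal {k : ℕ} (U : Machine k) (e : Machine 0 → List Bool) : Prop where
  selfDelimiting : ∀ Z Z', e Z <+: e Z' → Z = Z'
  simulates : ∀ Z x w, U.Outputs (e Z ++ x) w ↔ Z.Outputs x w

/-- The time bound `t_U(Zx) ≤ c_init |Zx| + c_run t_Z(|x|)`, where the slowdown `c_run` may depend
on the simulated machine `Z`, but not on its input. -/
def HasLinearOverhead {k : ℕ} (U : Machine k) (e : Machine 0 → List Bool) : Prop :=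
  ∃ c_init : ℕ, ∀ Z : Machine 0, ∃ c_run : ℕ, ∀ x : List Bool,
    U.time (e Z ++ x) ≤
      (c_init : ℕ∞) * ((e Z ++ x).length : ℕ∞) + (c_run : ℕ∞) * Z.timeComplexity x.length

/-- The Kolmogorov complexity `K(w) = min {|Zx| : U(Zx) = w}`. -/
noncomputable def K {k : ℕ} (U : Machine k) (e : Machine 0 → List Bool) (w : List Bool) : ℕ∞ :=
  ⨅ (Z : Machine 0) (x : List Bool) (_ : U.Outputs (e Z ++ x) w), ((e Z ++ x).length : ℕ∞)

/-- The Kolmogorov time complexity `K_T(w) = min {t_U(Zx) : U(Zx) = w, |Zx| = K(w)}`. -/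
noncomputable def KT {k : ℕ} (U : Machine k) (e : Machine 0 → List Bool) (w : List Bool) : ℕ∞ :=
  ⨅ (Z : Machine 0) (x : List Bool) (_ : U.Outputs (e Z ++ x) w)
    (_ : ((e Z ++ x).length : ℕ∞) = K U e w), U.time (e Z ++ x)

end Kolm

/-!
The second half is short: if `Z` halts at once, then `Z(w) = w` and `t_Z = 0`. Hence, when
`K(w) = |w| + |Z|`, the word `Zw` is a shortest program for `w`, and it takes `U` at most
`c_init |Zw|` steps, where `c_init` does not depend on `Z`.

For the first half a universal machine `universal` with linear overhead is built. It has three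
tapes: tape `0` is the tape of the simulated machine `Z`, cell by cell; tape `1` is a read-only
program; tape `2` is a unary counter, whose value is the position of its head relative to a single
mark. The program lists the values of the transition function of `Z` in the order of the pairs
(state `q`, scanned symbol `a`), numbered `3 q + symbolIndex a`. Each value is a natural number
written in unary: its last decimal digit codes the action on the tape (or "halt"), and the rest is
three times the new state, which is just what the counter must hold to find the next value. So one
step of `Z` is simulated by adding the index of the scanned symbol to the counter, going back to the
start of the program, skipping as many values as the counter tells, and reading the value found
there, which acts on tape `0` and sets the counter (`reach_step`, `halts_of_step_eq_none`). This
takes a number of steps linear in the length of the program. The description of `Z` is the program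
with a bit `1` before each letter and a bit `0` at the end; it is erased from tape `0` while it is
copied to tape `1`, so that afterwards tape `0` holds the input alone, and at the end exactly
what the tape of `Z` holds.
-/

namespace Kolm

open Turing

/-! ### Runs of machines -/

namespace Machine

variable {k : ℕ} {M : Machine k}

/-- `M` gets from one configuration to another in exactly `m` steps. -/
def Reach (M : Machine k) : ℕ → M.Cfg → M.Cfg → Prop
  | 0, c, d => c = d
  | m + 1, c, d => ∃ b, M.step c = some b ∧ Reach M m b d

theorem Reach.trans {m n : ℕ} {a b c : M.Cfg} (h : M.Reach m a b) (h' : M.Reach n b c) :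
    M.Reach (m + n) a c := by
  induction m generalizing a with
  | zero => cases h; simpa using h'
  | succ m ih =>
    obtain ⟨d, hd, h⟩ := h
    rw [Nat.add_right_comm]
    exact ⟨d, hd, ih h⟩

theorem Reach.head {n : ℕ} {a b c : M.Cfg} (h : M.step a = some b) (h' : M.Reach n b c) :
    M.Reach (n + 1) a c := ⟨b, h, h'⟩

theorem Reach.single {a b : M.Cfg} (h : M.step a = some b) : M.Reach 1 a b := ⟨b, h, rfl⟩

theorem run_add {x : List Bool} {s m : ℕ} {c d : M.Cfg} (h : M.run x s = some c)
    (h' : M.Reach m c d) : M.run x (s + m) = some d := by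
  induction m generalizing s c with
  | zero => cases h'; exact h
  | succ m ih =>
    obtain ⟨b, hb, h'⟩ := h'
    rw [← Nat.add_assoc, Nat.add_right_comm]
    exact ih (by simp [run, h, hb]) h'

theorem run_eq_none_of_le {x : List Bool} {s t : ℕ} (h : M.run x s = none) (hst : s ≤ t) :
    M.run x t = none := by
  induction t, hst using Nat.le_induction with
  | base => exact h
  | succ t _ ih => simp [run, ih]

theorem HaltsAt.run_succ {x : List Bool} {m : ℕ} {c : M.Cfg} (h : M.HaltsAt x m c) :
    M.run x (m + 1) = none := by
  simp [run, h.1, h.2]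

theorem HaltsAt.unique {x : List Bool} {m m' : ℕ} {c c' : M.Cfg} (h : M.HaltsAt x m c)
    (h' : M.HaltsAt x m' c') : m = m' ∧ c = c' := by
  have aux : ∀ {m m' : ℕ} {c c' : M.Cfg}, M.HaltsAt x m c → M.HaltsAt x m' c' → m' ≤ m := by
    intro m m' c c' h h'
    by_contra! hlt
    simpa [h'.1] using run_eq_none_of_le h.run_succ hlt
  obtain rfl := le_antisymm (aux h' h) (aux h h')
  exact ⟨rfl, Option.some.inj (h.1.symm.trans h'.1)⟩

theorem exists_haltsAt_or_forall_run (M : Machine k) (x : List Bool) :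
    (∃ m c, M.HaltsAt x m c) ∨ ∀ m, ∃ c, M.run x m = some c := by
  by_contra! h
  obtain ⟨h, m, hm⟩ := h
  induction m with
  | zero => exact hm _ rfl
  | succ m ih =>
    refine ih fun c hc => ?_
    cases hs : M.step c with
    | none => exact h m c ⟨hc, hs⟩
    | some d => exact hm d (by simp [run, hc, hs])

theorem HaltsAt.time_le {x : List Bool} {m : ℕ} {c : M.Cfg} (h : M.HaltsAt x m c) :
    M.time x ≤ m :=
  iInf₂_le m ⟨c, h⟩

theorem HaltsAt.le_time {x : List Bool} {m : ℕ} {c : M.Cfg} (h : M.HaltsAt x m c) :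
    (m : ℕ∞) ≤ M.time x :=
  le_iInf₂ fun _ ⟨_, h'⟩ => by rw [(h.unique h').1]

theorem time_eq_top {x : List Bool} (h : ∀ m c, ¬ M.HaltsAt x m c) : M.time x = ⊤ :=
  iInf₂_eq_top.2 fun m ⟨c, hc⟩ => absurd hc (h m c)

theorem time_le_timeComplexity (M : Machine k) (x : List Bool) :
    M.time x ≤ M.timeComplexity x.length :=
  le_iSup₂ (f := fun (y : List Bool) (_ : y.length = x.length) => M.time y) x rfl

end Machine

open Machine

/-! ### Tapes -/

/-- The tape that holds the word `l` reversed to the left of the head, and the word `r` from the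
head on. -/
def wordTape (l r : List Bool) : Tape (Option Bool) := Tape.mk₂ (l.map some) (r.map some)

/-- A blank before the first letter may be taken to be part of the blank half-tape. -/
theorem cons_none_mk_nil :
    ListBlank.cons none (ListBlank.mk ([] : List (Option Bool))) = ListBlank.mk [] :=
  ListBlank.cons_head_tail (ListBlank.mk [])

@[simp] theorem wordTape_head_cons (l r : List Bool) (b : Bool) :
    (wordTape l (b :: r)).head = some b := rfl

@[simp] theorem wordTape_head_nil (l : List Bool) : (wordTape l []).head = none := rfl

@[simp] theorem wordTape_move_right (l r : List Bool) (b : Bool) :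
    (wordTape l (b :: r)).move Dir.right = wordTape (b :: l) r := by
  simp [wordTape, Tape.mk₂]

@[simp] theorem wordTape_move_left (l r : List Bool) (b : Bool) :
    (wordTape (b :: l) r).move Dir.left = wordTape l (b :: r) := by
  simp [wordTape, Tape.mk₂]

@[simp] theorem act_wordTape_erase (r : List Bool) (b : Bool) :
    act (wordTape [] (b :: r)) none (some .right) = wordTape [] r := by
  change ((wordTape [] (b :: r)).write none).move Dir.right = wordTape [] r
  simp only [wordTape, Tape.mk₂, List.map_cons, List.map_nil, ← ListBlank.cons_mk, Tape.write_mk',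
    ListBlank.tail_cons, Tape.move_right_mk', ListBlank.head_cons, cons_none_mk_nil]

@[simp] theorem act_wordTape_write (l : List Bool) (b : Bool) :
    act (wordTape l []) (some b) (some .right) = wordTape (b :: l) [] := by
  simp [act, wordTape, Tape.mk₂]

theorem wordTape_left_end_head (r : List Bool) :
    ((wordTape [] r).move Dir.left).head = none := by
  simp [wordTape, Tape.mk₂]
  rfl

/-! Writing the scanned symbol again changes nothing. The lemmas below recognize this case from the
form of the tape. -/

theorem act_none_of_head {T : Tape (Option Bool)} {a : Option Bool} (h : T.head = a) :
    act T a none = T := by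
  subst h; exact T.write_self

theorem act_some_of_head {T : Tape (Option Bool)} {a : Option Bool} (h : T.head = a) (d : Dir) :
    act T a (some d) = T.move d := by
  subst h; exact congrArg (Tape.move d) T.write_self

@[simp] theorem act_head_none (T : Tape (Option Bool)) : act T T.head none = T :=
  act_none_of_head rfl

@[simp] theorem act_head_some (T : Tape (Option Bool)) (d : Dir) :
    act T T.head (some d) = T.move d :=
  act_some_of_head rfl d

@[simp] theorem act_wordTape_cons_none (l r : List Bool) (b : Bool) :
    act (wordTape l (b :: r)) (some b) none = wordTape l (b :: r) :=
  act_none_of_head rfl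

@[simp] theorem act_wordTape_nil_none (l : List Bool) :
    act (wordTape l []) none none = wordTape l [] :=
  act_none_of_head rfl

@[simp] theorem act_wordTape_cons_some (l r : List Bool) (b : Bool) (d : Dir) :
    act (wordTape l (b :: r)) (some b) (some d) = (wordTape l (b :: r)).move d :=
  act_some_of_head rfl d

@[simp] theorem act_wordTape_nil_some (l : List Bool) (d : Dir) :
    act (wordTape l []) none (some d) = (wordTape l []).move d :=
  act_some_of_head rfl d

/-- The tape with a single mark `1`, `c` cells to the left of the head. -/
def counter (c : ℕ) : Tape (Option Bool) := (Tape.move Dir.right)^[c] (wordTape [] [true])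

@[simp] theorem counter_move_right (c : ℕ) : (counter c).move Dir.right = counter (c + 1) :=
  (Function.iterate_succ_apply' _ _ _).symm

@[simp] theorem counter_move_left (c : ℕ) : (counter (c + 1)).move Dir.left = counter c := by
  rw [← counter_move_right, Tape.move_right_left]

@[simp] theorem counter_head_zero : (counter 0).head = some true := rfl

@[simp] theorem counter_head_succ (c : ℕ) : (counter (c + 1)).head = none := by
  rw [counter, Tape.move_right_n_head, wordTape, Tape.mk₂, Tape.mk'_nth_nat, ListBlank.nth_mk]
  cases c <;> rfl

@[simp] theorem act_wordTape_mark : act (wordTape [] []) (some true) none = counter 0 := by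
  simp [act, wordTape, Tape.mk₂, counter]

/-! ### The description of a machine -/

/-- The position of a symbol among the three symbols of the alphabet. -/
def symbolIndex : Option Bool → ℕ
  | none => 0
  | some false => 1
  | some true => 2

/-- The symbol at the given position, a left inverse of `symbolIndex`. -/
def symbolAt : ℕ → Option Bool
  | 0 => none
  | 1 => some false
  | _ => some true

theorem symbolAt_symbolIndex (a : Option Bool) : symbolAt (symbolIndex a) = a := by
  rcases a with _ | _ | _ <;> rfl

theorem symbolIndex_lt (a : Option Bool) : symbolIndex a < 3 := by
  rcases a with _ | _ | _ <;> simp [symbolIndex]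

instance : Fintype Dir := ⟨{Dir.left, Dir.right}, by rintro (_ | _) <;> simp⟩

/-- A numbering of the actions on a single tape: halting, or writing and moving. -/
noncomputable def actionEquiv : Option (Option Bool × Option Dir) ≃ Fin 10 :=
  Fintype.equivFinOfCardEq (by simp [Fintype.card_prod, Fintype.card_option]; rfl)

/-- The code of a value of the transition function of a single-tape machine: the last decimal digit
is the action, the rest is three times the new state. -/
noncomputable def ruleCode {n : ℕ} :
    Option (Fin (n + 1) × (Fin 1 → Option Bool) × (Fin 1 → Option Dir)) → ℕ
  | none => actionEquiv none
  | some (q, b, d) => 10 * (3 * q) + actionEquiv (some (b 0, d 0))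

theorem ruleCode_injective {n : ℕ} : Function.Injective (ruleCode (n := n)) := by
  have key : ∀ (i j : ℕ) (s t : Fin 10), 10 * (3 * i) + (s : ℕ) = 10 * (3 * j) + t →
      i = j ∧ s = t := fun i j s t h => by omega
  rintro (_ | ⟨q, b, d⟩) (_ | ⟨q', b', d'⟩) h
  · rfl
  · have := (key 0 q' _ _ (by simpa [ruleCode] using h)).2
    simp at this
  · have := (key q 0 _ _ (by simpa [ruleCode] using h)).2
    simp at this
  · obtain ⟨h1, h2⟩ := key _ _ _ _ h
    have h3 := actionEquiv.injective h2
    simp only [Option.some.injEq, Prod.mk.injEq] at h3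
    have hb : b = b' := by ext1 i; rw [Subsingleton.elim i 0, h3.1]
    have hd : d = d' := by ext1 i; rw [Subsingleton.elim i 0, h3.2]
    rw [hb, hd, Fin.ext h1]

/-- The codes of the values of the transition function; the number `3 q + symbolIndex a` is the
one for the state `q` and the symbol `a`. -/
noncomputable def rules (Z : Machine 0) : List ℕ :=
  (List.range (3 * (Z.n + 1))).map fun i =>
    ruleCode (Z.δ (Fin.ofNat (Z.n + 1) (i / 3)) fun _ => symbolAt (i % 3))

theorem rules_get? (Z : Machine 0) (q : Fin (Z.n + 1)) (a : Fin 1 → Option Bool) :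
    (rules Z)[3 * (q : ℕ) + symbolIndex (a 0)]? = some (ruleCode (Z.δ q a)) := by
  have ha := symbolIndex_lt (a 0)
  have hlt : 3 * (q : ℕ) + symbolIndex (a 0) < 3 * (Z.n + 1) := by omega
  have h1 : (3 * (q : ℕ) + symbolIndex (a 0)) / 3 = q := by omega
  have h2 : (3 * (q : ℕ) + symbolIndex (a 0)) % 3 = symbolIndex (a 0) := by omega
  have h3 : (fun _ => a 0) = a := by ext1 i; rw [Subsingleton.elim i 0]
  simp [rules, List.getElem?_range hlt, h1, h2, symbolAt_symbolIndex, h3]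

theorem rules_injective : Function.Injective rules := by
  rintro ⟨n, δ⟩ ⟨n', δ'⟩ h
  have hlen := congrArg List.length h
  simp only [rules, List.length_map, List.length_range] at hlen
  obtain rfl : n = n' := by omega
  congr 1
  funext q a
  have h1 := rules_get? ⟨n, δ⟩ q a
  have h2 := rules_get? ⟨n, δ'⟩ q a
  rw [h] at h1
  exact ruleCode_injective (Option.some.inj (h1.symm.trans h2))

theorem exists_rules_split (Z : Machine 0) (q : Fin (Z.n + 1)) (a : Fin 1 → Option Bool) :
    ∃ pre post, rules Z = pre ++ ruleCode (Z.δ q a) :: post ∧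
      pre.length = 3 * (q : ℕ) + symbolIndex (a 0) := by
  obtain ⟨h, hget⟩ := List.getElem?_eq_some_iff.1 (rules_get? Z q a)
  refine ⟨_, (rules Z).drop (3 * (q : ℕ) + symbolIndex (a 0) + 1), ?_,
    List.length_take_of_le h.le⟩
  rw [← hget, ← List.drop_eq_getElem_cons h, List.take_append_drop]

/-- A list of numbers in unary, each one closed by a `0`. -/
def unary (ns : List ℕ) : List Bool := ns.flatMap fun n => List.replicate n true ++ [false]

@[simp] theorem unary_nil : unary [] = [] := rfl

@[simp] theorem unary_cons (n : ℕ) (ns : List ℕ) :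
    unary (n :: ns) = List.replicate n true ++ false :: unary ns := by
  simp [unary]

@[simp] theorem unary_append (ns ms : List ℕ) : unary (ns ++ ms) = unary ns ++ unary ms := by
  simp [unary]

theorem length_le_length_unary (ns : List ℕ) : ns.length ≤ (unary ns).length := by
  induction ns with
  | nil => simp
  | cons n ns ih => simp; omega

theorem replicate_true_false_inj {n m : ℕ} {r r' : List Bool}
    (h : List.replicate n true ++ false :: r = List.replicate m true ++ false :: r') :
    n = m ∧ r = r' := by
  induction n generalizing m with
  | zero => cases m <;> simp_all [List.replicate_succ]
  | succ n ih =>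
    cases m with
    | zero => simp [List.replicate_succ] at h
    | succ m =>
      simp only [List.replicate_succ, List.cons_append, List.cons.injEq, true_and] at h
      simpa using ih h

theorem unary_injective : Function.Injective unary := by
  intro ns ms h
  induction ns generalizing ms with
  | nil => cases ms <;> simp_all
  | cons n ns ih =>
    cases ms with
    | nil => simp at h
    | cons m ms =>
      rw [unary_cons, unary_cons] at h
      obtain ⟨rfl, h'⟩ := replicate_true_false_inj h
      rw [ih h']

/-- The program of `Z`, the word that stands on tape `1` of the universal machine. -/
noncomputable def program (Z : Machine 0) : List Bool := unary (rules Z)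

/-- A word made self-delimiting: a `1` announces each letter, a `0` the end. -/
def delimit : List Bool → List Bool
  | [] => [false]
  | b :: l => true :: b :: delimit l

theorem length_delimit (l : List Bool) : (delimit l).length = 2 * l.length + 1 := by
  induction l with
  | nil => rfl
  | cons b l ih => simp [delimit, ih]; ring

theorem eq_of_delimit_prefix {l l' : List Bool} (h : delimit l <+: delimit l') : l = l' := by
  induction l generalizing l' with
  | nil => cases l' <;> simp_all [delimit]
  | cons b l ih =>
    cases l' with
    | nil => simp [delimit] at h
    | cons b' l' =>
      simp only [delimit, List.cons_prefix_cons, true_and] at h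
      rw [h.1, ih h.2]

/-- The self-delimiting description of `Z`. -/
noncomputable def description (Z : Machine 0) : List Bool := delimit (program Z)

/-! ### The universal machine -/

/-- The states of the universal machine: `load` and `loadBit` copy the program, `dispatch` and
`incr` add the index of the scanned symbol to the counter, `rewind` goes to the start of the
program, `seek` and `skip` look for the rule numbered by the counter, and `exec t` reads it, `t`
being the number of its units read so far modulo `10`. -/
inductive Control
  | load | loadBit | dispatch | incr | rewind | seek | skip
  | exec (t : Fin 10)

/-- The control states numbered from `0`, which is `load`. -/
def Control.equivFin : Control ≃ Fin (16 + 1) where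
  toFun
    | .load => 0
    | .loadBit => 1
    | .dispatch => 2
    | .incr => 3
    | .rewind => 4
    | .seek => 5
    | .skip => 6
    | .exec t => ⟨t + 7, by omega⟩
  invFun i :=
    if h : 7 ≤ (i : ℕ) then .exec ⟨i - 7, by omega⟩ else
      match (i : ℕ) with
      | 0 => .load
      | 1 => .loadBit
      | 2 => .dispatch
      | 3 => .incr
      | 4 => .rewind
      | 5 => .seek
      | _ => .skip
  left_inv s := by cases s <;> simp
  right_inv i := by revert i; decide

/-- The transition function of the universal machine, as a function of the control state and the
scanned symbols of the three tapes: for each tape it gives the symbol to be written and the move.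
The counter is `0` when tape `2` shows its mark, so `seek` decides by that symbol. In `exec t` the
sum `t + 1` is taken modulo `10`, and the counter grows when it wraps; the machine halts when the
digit reached codes halting. -/
noncomputable def transition : Control → Option Bool → Option Bool → Option Bool →
    Option (Control × (Option Bool × Option Dir) × (Option Bool × Option Dir) ×
      (Option Bool × Option Dir))
  | .load, some true, a₁, a₂ =>
    some (.loadBit, (none, some .right), (a₁, none), (a₂, none))
  | .load, some false, a₁, _ =>
    some (.dispatch, (none, some .right), (a₁, some .left), (some true, none))
  | .load, none, _, _ => none
  | .loadBit, some b, _, a₂ =>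
    some (.load, (none, some .right), (some b, some .right), (a₂, none))
  | .loadBit, none, _, _ => none
  | .dispatch, none, a₁, a₂ => some (.rewind, (none, none), (a₁, none), (a₂, none))
  | .dispatch, some false, a₁, a₂ =>
    some (.rewind, (some false, none), (a₁, none), (a₂, some .right))
  | .dispatch, some true, a₁, a₂ =>
    some (.incr, (some true, none), (a₁, none), (a₂, some .right))
  | .incr, a₀, a₁, a₂ => some (.rewind, (a₀, none), (a₁, none), (a₂, some .right))
  | .rewind, a₀, some b, a₂ => some (.rewind, (a₀, none), (some b, some .left), (a₂, none))
  | .rewind, a₀, none, a₂ => some (.seek, (a₀, none), (none, some .right), (a₂, none))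
  | .seek, a₀, a₁, some b => some (.exec 0, (a₀, none), (a₁, none), (some b, none))
  | .seek, a₀, a₁, none => some (.skip, (a₀, none), (a₁, none), (none, some .left))
  | .skip, a₀, some true, a₂ =>
    some (.skip, (a₀, none), (some true, some .right), (a₂, none))
  | .skip, a₀, some false, a₂ =>
    some (.seek, (a₀, none), (some false, some .right), (a₂, none))
  | .skip, _, none, _ => none
  | .exec t, a₀, some true, a₂ =>
    some (.exec (t + 1), (a₀, none), (some true, some .right),
      (a₂, if t = 9 then some .right else none))
  | .exec t, _, some false, a₂ =>
    (actionEquiv.symm t).map fun r => (.dispatch, r, (some false, none), (a₂, none))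
  | .exec _, _, none, _ => none

/-- The universal machine. -/
noncomputable def universal : Machine 2 where
  n := 16
  δ s a := (transition (Control.equivFin.symm s) (a 0) (a 1) (a 2)).map fun r =>
    (Control.equivFin r.1, ![r.2.1.1, r.2.2.1.1, r.2.2.2.1], ![r.2.1.2, r.2.2.1.2, r.2.2.2.2])

/-- The configuration of the universal machine with the given control state and tapes. -/
def config (s : Control) (T₀ T₁ T₂ : Tape (Option Bool)) : universal.Cfg :=
  ⟨Control.equivFin s, ![T₀, T₁, T₂]⟩

theorem step_config (s : Control) (T₀ T₁ T₂ : Tape (Option Bool)) :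
    universal.step (config s T₀ T₁ T₂) =
      (transition s T₀.head T₁.head T₂.head).map fun r =>
        config r.1 (act T₀ r.2.1.1 r.2.1.2) (act T₁ r.2.2.1.1 r.2.2.1.2)
          (act T₂ r.2.2.2.1 r.2.2.2.2) := by
  have h : Control.equivFin.symm (Control.equivFin s) = s := Equiv.symm_apply_apply _ _
  simp only [step, universal, config, Matrix.cons_val, h, Option.map_map]
  congr 1
  funext r
  simp only [Function.comp, Cfg.mk.injEq, true_and]
  funext i
  fin_cases i <;> rfl

theorem init_universal (x : List Bool) :
    universal.init x = config .load (wordTape [] x) (wordTape [] []) (wordTape [] []) := by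
  simp only [init, config]
  congr 1
  funext i
  fin_cases i <;> rfl

/-! ### The phases of the simulation -/

/-- Loading a program: it is erased from tape `0` and appended to tape `1`, and the mark of the
counter is set. -/
theorem reach_load (p x l : List Bool) :
    universal.Reach (2 * p.length + 1)
      (config .load (wordTape [] (delimit p ++ x)) (wordTape l []) (wordTape [] []))
      (config .dispatch (wordTape [] x)
        ((wordTape (p.reverse ++ l) []).move .left) (counter 0)) := by
  induction p generalizing l with
  | nil =>
    refine Reach.single ?_
    simp [step_config, delimit, transition]
  | cons c p ih =>
    have := ih (c :: l)
    rw [show (c :: p).reverse ++ l = p.reverse ++ c :: l by simp]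
    refine Reach.head (b := config .loadBit (wordTape [] (c :: (delimit p ++ x)))
      (wordTape l []) (wordTape [] [])) ?_ (Reach.head ?_ this)
    · simp [step_config, delimit, transition]
    · simp [step_config, transition]

/-- The index of the symbol scanned on tape `0` is added to the counter. -/
theorem reach_dispatch (T₀ T₁ : Tape (Option Bool)) (c : ℕ) :
    ∃ m ≤ 2, universal.Reach (m + 1) (config .dispatch T₀ T₁ (counter c))
      (config .rewind T₀ T₁ (counter (c + symbolIndex T₀.head))) := by
  rcases h : T₀.head with _ | _ | _
  · refine ⟨0, by omega, Reach.single ?_⟩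
    simp [step_config, h, transition, symbolIndex, act_none_of_head]
  · refine ⟨0, by omega, Reach.single ?_⟩
    simp [step_config, h, transition, symbolIndex, act_none_of_head]
  · refine ⟨1, by omega, Reach.head (b := config .incr T₀ T₁ (counter (c + 1))) ?_
      (Reach.single ?_)⟩
    · simp [step_config, h, transition, act_none_of_head]
    · simp [step_config, transition, symbolIndex, act_some_of_head (counter_head_succ c)]

theorem reach_rewind (T₀ T₂ : Tape (Option Bool)) (l r : List Bool) (b : Bool) :
    universal.Reach (l.length + 2) (config .rewind T₀ (wordTape l (b :: r)) T₂)
      (config .seek T₀ (wordTape [] (l.reverse ++ b :: r)) T₂) := by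
  induction l generalizing b r with
  | nil =>
    refine Reach.head (b := config .rewind T₀ ((wordTape [] (b :: r)).move .left) T₂) ?_
      (Reach.single ?_)
    · simp [step_config, transition]
    · simp [step_config, transition, wordTape_left_end_head,
        act_some_of_head (wordTape_left_end_head _)]
  | cons c l ih =>
    have := ih (b :: r) c
    rw [show (c :: l).reverse ++ b :: r = l.reverse ++ c :: b :: r by simp]
    refine Reach.head ?_ this
    simp [step_config, transition]

theorem reach_skip (T₀ T₂ : Tape (Option Bool)) (l r : List Bool) (n : ℕ) :
    universal.Reach (n + 1) (config .skip T₀ (wordTape l (List.replicate n true ++ false :: r)) T₂)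
      (config .seek T₀ (wordTape (false :: (List.replicate n true ++ l)) r) T₂) := by
  induction n generalizing l with
  | zero =>
    refine Reach.single ?_
    simp [step_config, transition]
  | succ n ih =>
    have := ih (true :: l)
    rw [show List.replicate n true ++ true :: l = List.replicate (n + 1) true ++ l by
      simp [List.replicate_succ']] at this
    refine Reach.head ?_ this
    simp [step_config, transition, List.replicate_succ]

/-- As many unary numbers are skipped as the counter tells. -/
theorem reach_seek (T₀ : Tape (Option Bool)) (l r : List Bool) (ns : List ℕ) :
    universal.Reach ((unary ns).length + ns.length + 1)
      (config .seek T₀ (wordTape l (unary ns ++ r)) (counter ns.length))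
      (config (.exec 0) T₀ (wordTape ((unary ns).reverse ++ l) r) (counter 0)) := by
  induction ns generalizing l with
  | nil =>
    refine Reach.single ?_
    simp [step_config, transition, act_none_of_head counter_head_zero]
  | cons n ns ih =>
    have h1 := reach_skip T₀ (counter ns.length) l (unary ns ++ r) n
    have h2 := h1.trans (ih _)
    have h3 : (unary ns).reverse ++ (false :: (List.replicate n true ++ l)) =
      (unary (n :: ns)).reverse ++ l := by simp
    have h4 : unary (n :: ns) ++ r = List.replicate n true ++ false :: (unary ns ++ r) := by simp
    rw [h3, ← h4] at h2
    have h5 : (unary (n :: ns)).length + (n :: ns).length + 1 =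
      n + 1 + ((unary ns).length + ns.length + 1) + 1 := by simp; ring
    rw [h5]
    refine Reach.head ?_ h2
    simp [step_config, transition, act_some_of_head]

/-- Reading `m` units adds to the counter the number of full tens, and leaves the last digit in the
state. -/
theorem reach_exec (T₀ : Tape (Option Bool)) (l r : List Bool) (m c k : ℕ) (t t' : Fin 10)
    (h : (t : ℕ) + m = 10 * k + t') :
    universal.Reach m
      (config (.exec t) T₀ (wordTape l (List.replicate m true ++ r)) (counter c))
      (config (.exec t') T₀ (wordTape (List.replicate m true ++ l) r) (counter (c + k))) := by
  induction m generalizing l c k t with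
  | zero =>
    obtain rfl : t = t' := by omega
    obtain rfl : k = 0 := by omega
    rfl
  | succ m ih =>
    have hl : List.replicate m true ++ true :: l = List.replicate (m + 1) true ++ l := by
      simp [List.replicate_succ']
    rcases eq_or_ne t 9 with rfl | ht
    · obtain ⟨k, rfl⟩ : ∃ k', k = k' + 1 := ⟨k - 1, by simp at h; omega⟩
      have := ih (true :: l) (c + 1) k (9 + 1) (by simp at h ⊢; omega)
      rw [hl, Nat.add_right_comm, Nat.add_assoc] at this
      refine Reach.head ?_ this
      simp [step_config, transition, List.replicate_succ]
    · have := ih (true :: l) c k (t + 1) (by omega)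
      rw [hl] at this
      refine Reach.head ?_ this
      simp [step_config, transition, List.replicate_succ, ht]

/-- The tape holds the word `p`, and its head is on one of the letters. -/
def OnWord (p : List Bool) (T : Tape (Option Bool)) : Prop :=
  ∃ l b r, T = wordTape l (b :: r) ∧ l.reverse ++ b :: r = p

/-- From a configuration of `Z`, the universal machine finds the rule that applies and reads its
code, up to the `0` that closes it. -/
theorem reach_rule (Z : Machine 0) (q : Fin (Z.n + 1)) (a : Fin 1 → Option Bool)
    (T₀ T₁ : Tape (Option Bool)) (ha : a 0 = T₀.head) (hT₁ : OnWord (program Z) T₁) (k : ℕ)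
    (t : Fin 10) (hk : ruleCode (Z.δ q a) = 10 * k + t) :
    ∃ m ≤ 4 * (program Z).length + 4, ∃ l r, l.reverse ++ false :: r = program Z ∧
      universal.Reach m (config .dispatch T₀ T₁ (counter (3 * (q : ℕ))))
        (config (.exec t) T₀ (wordTape l (false :: r)) (counter k)) := by
  obtain ⟨l, b, r, rfl, hp⟩ := hT₁
  obtain ⟨pre, post, hrules, hpre⟩ := exists_rules_split Z q a
  obtain ⟨m, hm, h⟩ := reach_dispatch T₀ (wordTape l (b :: r)) (3 * (q : ℕ))
  have h := h.trans (reach_rewind T₀ _ l r b)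
  have hprog : program Z = unary pre ++
      (List.replicate (ruleCode (Z.δ q a)) true ++ false :: unary post) := by
    simp [program, hrules]
  rw [hp, ← ha, ← hpre, hprog] at h
  have h := h.trans (reach_seek T₀ [] _ pre)
  have h := h.trans (reach_exec T₀ _ (false :: unary post) _ 0 k 0 t (by simpa using hk))
  rw [Nat.zero_add] at h
  refine ⟨_, ?_, _, _, ?_, h⟩
  · have h1 := congrArg List.length hp
    have h2 := congrArg List.length hprog
    have h3 := length_le_length_unary pre
    simp at h1 h2
    omega
  · simp [hprog]

/-- The simulation of one step of `Z`. The number of steps has a bound that depends on `Z` alone. -/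
theorem reach_step {Z : Machine 0} {c c' : Z.Cfg} (hc : Z.step c = some c')
    {T₁ : Tape (Option Bool)} (hT₁ : OnWord (program Z) T₁) :
    ∃ m ≤ 4 * (program Z).length + 4, ∃ T₁', OnWord (program Z) T₁' ∧
      universal.Reach (m + 1) (config .dispatch (c.tape 0) T₁ (counter (3 * (c.state : ℕ))))
        (config .dispatch (c'.tape 0) T₁' (counter (3 * (c'.state : ℕ)))) := by
  obtain ⟨⟨q, b, d⟩, hδ, rfl⟩ := Option.map_eq_some_iff.1 hc
  obtain ⟨m, hm, l, r, hlr, h⟩ := reach_rule Z c.state _ (c.tape 0) T₁ rfl hT₁ (3 * (q : ℕ))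
    (actionEquiv (some (b 0, d 0))) (by rw [hδ]; rfl)
  refine ⟨m, hm, _, ⟨l, false, r, rfl, hlr⟩, h.trans (Reach.single ?_)⟩
  simp [step_config, transition]

/-- When `Z` has halted, the universal machine halts too, without touching tape `0`. -/
theorem halts_of_step_eq_none {Z : Machine 0} {c : Z.Cfg} (hc : Z.step c = none)
    {T₁ : Tape (Option Bool)} (hT₁ : OnWord (program Z) T₁) :
    ∃ m ≤ 4 * (program Z).length + 4, ∃ d, universal.step d = none ∧ d.tape 0 = c.tape 0 ∧
      universal.Reach m (config .dispatch (c.tape 0) T₁ (counter (3 * (c.state : ℕ)))) d := by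
  have hδ := Option.map_eq_none_iff.1 hc
  obtain ⟨m, hm, l, r, -, h⟩ := reach_rule Z c.state _ (c.tape 0) T₁ rfl hT₁ 0
    (actionEquiv none) (by rw [hδ]; simp [ruleCode])
  refine ⟨m, hm, _, ?_, rfl, h⟩
  simp [step_config, transition]

/-- After a nonempty word has been loaded, one move to the left puts the head on its last letter. -/
theorem onWord_load {p : List Bool} (hp : p ≠ []) :
    OnWord p ((wordTape (p.reverse ++ []) []).move .left) := by
  obtain ⟨b, l, h⟩ := List.exists_cons_of_ne_nil (List.reverse_ne_nil_iff.2 hp)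
  refine ⟨l, b, [], by simp [h], ?_⟩
  rw [← List.reverse_cons, ← h, List.reverse_reverse]

theorem program_ne_nil (Z : Machine 0) : program Z ≠ [] := by
  intro h
  have := length_le_length_unary (rules Z)
  rw [← program, h] at this
  simp [rules] at this

/-- After `m` steps of `Z` the universal machine has made at least `m` steps, so that it cannot halt
if `Z` does not, and at most the number of steps that linear overhead allows. -/
theorem run_universal {Z : Machine 0} {x : List Bool} {m : ℕ} {c : Z.Cfg}
    (h : Z.run x m = some c) :
    ∃ s, m ≤ s ∧ s ≤ 2 * (program Z).length + 1 + m * (4 * (program Z).length + 5) ∧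
      ∃ T₁, OnWord (program Z) T₁ ∧ universal.run (description Z ++ x) s =
        some (config .dispatch (c.tape 0) T₁ (counter (3 * (c.state : ℕ)))) := by
  induction m generalizing c with
  | zero =>
    cases h
    refine ⟨0 + (2 * (program Z).length + 1), by omega, by omega, _,
      onWord_load (program_ne_nil Z), run_add ?_ (reach_load _ x [])⟩
    rw [run, init_universal, description]
  | succ m ih =>
    obtain ⟨b, hb, hstep⟩ := Option.bind_eq_some_iff.1 h
    obtain ⟨s, hms, hs, T₁, hT₁, hrun⟩ := ih hb
    obtain ⟨j, hj, T₁', hT₁', hreach⟩ := reach_step hstep hT₁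
    refine ⟨s + (j + 1), by omega, ?_, T₁', hT₁', run_add hrun hreach⟩
    rw [Nat.add_one_mul m]
    omega

theorem haltsAt_universal {Z : Machine 0} {x : List Bool} {m : ℕ} {c : Z.Cfg}
    (h : Z.HaltsAt x m c) :
    ∃ s ≤ 6 * (description Z).length + m * (4 * (program Z).length + 5), ∃ d,
      universal.HaltsAt (description Z ++ x) s d ∧ d.tape 0 = c.tape 0 := by
  obtain ⟨s, -, hs, T₁, hT₁, hrun⟩ := run_universal h.1
  obtain ⟨j, hj, d, hd, htape, hreach⟩ := halts_of_step_eq_none h.2 hT₁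
  refine ⟨s + j, ?_, d, ⟨run_add hrun hreach, hd⟩, htape⟩
  rw [description, length_delimit]
  omega

theorem not_haltsAt_universal {Z : Machine 0} {x : List Bool} (h : ∀ m, ∃ c, Z.run x m = some c)
    (m : ℕ) (d : universal.Cfg) : ¬ universal.HaltsAt (description Z ++ x) m d := by
  intro hd
  obtain ⟨c, hc⟩ := h (m + 1)
  obtain ⟨s, hms, -, T₁, -, hrun⟩ := run_universal hc
  simpa [hrun] using run_eq_none_of_le hd.run_succ hms

theorem isUniversal_universal : IsUniversal universal description where
  selfDelimiting _ _ h := rules_injective (unary_injective (eq_of_delimit_prefix h))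
  simulates Z x w := by
    constructor
    · rintro ⟨s, d, hd, hw⟩
      rcases exists_haltsAt_or_forall_run Z x with ⟨m, c, hc⟩ | h
      · obtain ⟨s', -, d', hd', htape⟩ := haltsAt_universal hc
        rw [(hd.unique hd').2, htape] at hw
        exact ⟨m, c, hc, hw⟩
      · exact absurd hd (not_haltsAt_universal h s d)
    · rintro ⟨m, c, hc, hw⟩
      obtain ⟨s, -, d, hd, htape⟩ := haltsAt_universal hc
      exact ⟨s, d, hd, by rwa [htape]⟩

theorem hasLinearOverhead_universal : HasLinearOverhead universal description := by
  refine ⟨6, fun Z => ⟨4 * (program Z).length + 5, fun x => ?_⟩⟩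
  have hmono := time_le_timeComplexity Z x
  rcases exists_haltsAt_or_forall_run Z x with ⟨m, c, hc⟩ | h
  · obtain ⟨s, hs, d, hd, -⟩ := haltsAt_universal hc
    have hs' : s ≤ 6 * (description Z ++ x).length + (4 * (program Z).length + 5) * m := by
      rw [List.length_append, Nat.mul_comm _ m]
      omega
    calc universal.time (description Z ++ x) ≤ s := hd.time_le
      _ ≤ ((6 * (description Z ++ x).length + (4 * (program Z).length + 5) * m : ℕ) : ℕ∞) := by
        exact_mod_cast hs'
      _ = ((6 : ℕ) : ℕ∞) * ((description Z ++ x).length : ℕ∞) +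
          ((4 * (program Z).length + 5 : ℕ) : ℕ∞) * m := by push_cast; rfl
      _ ≤ _ := by
        gcongr
        exact hc.le_time.trans hmono
  · -- The bound is infinite, as the factor of the infinite `t_Z` is not `0`.
    have htop : Z.timeComplexity x.length = ⊤ := by
      refine top_le_iff.1 (le_of_eq_of_le (time_eq_top fun m c hc => ?_).symm hmono)
      obtain ⟨d, hd⟩ := h (m + 1)
      simp [hc.run_succ] at hd
    rw [htop, ENat.mul_top (by simp), add_top]
    exact le_top

/-! ### Machines that halt at once -/

theorem ImmediatelyHalts.haltsAt {Z : Machine 0} (hZ : ImmediatelyHalts Z) (x : List Bool) :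
    Z.HaltsAt x 0 (Z.init x) :=
  ⟨rfl, by simp [step, init, hZ _]⟩

theorem ImmediatelyHalts.timeComplexity {Z : Machine 0} (hZ : ImmediatelyHalts Z) (l : ℕ) :
    Z.timeComplexity l = 0 :=
  le_antisymm (iSup₂_le fun x _ => by simpa using (hZ.haltsAt x).time_le) zero_le

theorem ImmediatelyHalts.outputs {Z : Machine 0} (hZ : ImmediatelyHalts Z) (w : List Bool) :
    Z.Outputs w w := by
  refine ⟨0, _, hZ.haltsAt w, 0, fun j => ?_⟩
  change (Tape.mk₁ (w.map some)).nth j = _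
  split_ifs with hj
  · obtain ⟨i, rfl⟩ := Int.eq_negSucc_of_lt_zero hj
    change (ListBlank.mk []).nth i = none
    rw [ListBlank.nth_mk]
    rfl
  · obtain ⟨i, rfl⟩ := Int.eq_ofNat_of_zero_le (not_lt.1 hj)
    rw [Tape.mk₁, Tape.mk₂, Tape.mk'_nth_nat, ListBlank.nth_mk]
    simp only [List.getI_eq_getElem?_getD, List.getElem?_map, sub_zero, Int.toNat_natCast]
    cases w[i]? <;> rfl

end Kolm

theorem theorem1 :
    (∃ (k : ℕ) (U : Kolm.Machine k) (e : Kolm.Machine 0 → List Bool),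
      Kolm.IsUniversal U e ∧ Kolm.HasLinearOverhead U e) ∧
    ∀ (k : ℕ) (U : Kolm.Machine k) (e : Kolm.Machine 0 → List Bool),
      Kolm.IsUniversal U e → Kolm.HasLinearOverhead U e →
      ∃ c : ℕ, ∀ Z : Kolm.Machine 0, Kolm.ImmediatelyHalts Z →
        ∀ w : List Bool, Kolm.K U e w = (w.length : ℕ∞) + ((e Z).length : ℕ∞) →
          Kolm.KT U e w ≤ (c : ℕ∞) * Kolm.K U e w := by
  refine ⟨⟨2, Kolm.universal, Kolm.description, Kolm.isUniversal_universal,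
    Kolm.hasLinearOverhead_universal⟩, fun k U e hU ⟨c, hc⟩ => ⟨c, fun Z hZ w hK => ?_⟩⟩
  have hlen : ((e Z ++ w).length : ℕ∞) = Kolm.K U e w := by
    rw [hK, List.length_append, Nat.cast_add, add_comm]
  obtain ⟨c', hc'⟩ := hc Z
  calc Kolm.KT U e w ≤ U.time (e Z ++ w) :=
        (iInf₂_le Z w).trans (iInf₂_le ((hU.simulates Z w w).2 (hZ.outputs w)) hlen)
    _ ≤ _ := hc' w
    _ = c * Kolm.K U e w := by rw [hZ.timeComplexity, mul_zero, add_zero, hlen]
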